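/- There is a universal constant $C>0$ with the following property. Let $V$ be a set, let the set of triples $V^3$ carry a $\sigma$-algebra, and let $\mathcal H\subseteq\{0,1\}^{V^3}$ be a class of boolean classifiers $h(x,y,z)$ that contains at least two classifiers and has finite VC-dimension $d=\mathrm{VCdim}(\mathcal H)$ (for instance a class of contrastive classifiers $h_\rho(x,y,z)=\operatorname{sign}(\rho(x,y)-\rho(x,z))$). Suppose $\mathcal H$ is well behaved in the sense defined at the end, which is automatic when $V^3$ is countable and all its points are measurable. Then for every $0\le\eta<\tfrac12$, $0<\delta<1$ and $\Delta>0$ there is an integer $$N\le \frac{C}{\Delta^2}\Bigl(d+\log\frac1\delta\Bigr),\qquad N\ge 0,$$ such that for every $n\ge N$ there is a learning algorithm $A$, mapping labeled samples of size $n$ to elements of $\mathcal H$, which PAC learns $\mathcal H$ with accuracy $\varepsilon=2\eta+\Delta$ and confidence $\delta$ in the presence of nasty noise of rate $\eta$. This means: for every probability distribution $D$ on $V^3$, every target $h^*\in\mathcal H$ and every nasty adversary of rate $\eta$, the classifier $h=A(S)$ computed from the sample $S$ that the adversary returns satisfies $$\Pr_{(x,y,z)\sim D}\bigl[h(x,y,z)\ne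 h^*(x,y,z)\bigr]<2\eta+\Delta$$ except on an event of (outer) probability at most $\delta$. Here a nasty adversary of rate $\eta$ draws $n$ independent points from $D$, labels them by $h^*$, selects a set $J$ of positions and replaces the labeled examples at the positions in $J$ by arbitrary labeled examples, leaving the others unchanged. It knows $A$, $D$, $h^*$ and the whole drawn sample, may randomize, and may let $J$ and the replacements depend on all of this; the only restriction is that $|J|$ has the binomial distribution $\mathrm{Bin}(n,\eta)$. The class $\mathcal H$ is well behaved if each $h\in\mathcal H$ is measurable and, for every probability measure $D$ on $V^3$, all $h^*\in\mathcal H$ and all integers $n,k\ge 0$, the set of pairs of samples $(s,s')\in (V^3)^n\times(V^3)^n$ for which some $h\in\mathcal H$ satisfies $\bigl|\#\{i:h(s_i)\ne h^*(s_i)\}-\#\{i:h(s'_i)\ne h^*(s'_i)\}\bigr|>k$ is measurable with respect to the completion of $D^n\times D^n$. -/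

import Mathlib

open MeasureTheory ProbabilityTheory

universe u v

section Classes

variable {X : Type u}

/-- A finite set `T` is shattered by the class `H` if every labelling of the points of `T` is
realized by some member of `H`. -/
def ClassShatters (H : Set (X → Bool)) (T : Finset X) : Prop :=
  ∀ l : X → Bool, ∃ h ∈ H, ∀ x ∈ T, h x = l x

/-- The VC-dimension of a class: the supremum (possibly `⊤`) of the sizes of shattered sets. -/
noncomputable def classVCDim (H : Set (X → Bool)) : ℕ∞ :=
  ⨆ (T : Finset X) (_ : ClassShatters H T), (T.card : ℕ∞)

/-- The number of indices `i` at which `h` and `g` disagree on the `i`-th point of `x`. -/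
def disagreements {n : ℕ} (h g : X → Bool) (x : Fin n → X) : ℕ :=
  (Finset.univ.filter fun i => h (x i) ≠ g (x i)).card

/-- The measurability convention under which the uniform-convergence theory of VC classes is
formulated. Each hypothesis is measurable, and for a target `g` in the class and two samples of
size `n`, the event that some `h` in the class has numbers of disagreements with `g` on the
two samples that are more than `k` apart is universally measurable: it is null-measurable for
each product law `Dⁿ × Dⁿ`. Nothing is said about the probabilities of these events. All of this
is automatic when `X` is countable with measurable points. -/
structure WellBehavedClass [MeasurableSpace X] (H : Set (X → Bool)) : Prop where
  measurable : ∀ h ∈ H, Measurable h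
  nullMeasurableSet : ∀ (D : Measure X) [IsProbabilityMeasure D], ∀ g ∈ H, ∀ n k : ℕ,
    NullMeasurableSet
      {z : (Fin n → X) × (Fin n → X) | ∃ h ∈ H,
        (k : ℤ) < |(disagreements h g z.1 : ℤ) - (disagreements h g z.2 : ℤ)|}
      ((Measure.pi fun _ : Fin n => D).prod (Measure.pi fun _ : Fin n => D))

end Classes

section NastyNoise

variable {X : Type u} [MeasurableSpace X]

/-- What a nasty adversary of rate `η` does, with target `g`, distribution `D` and sample size `n`:
on a probability space `(Ω, P)`, `clean` is the original sample, drawn i.i.d. from `D`; `J` is the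
set of positions which the adversary may replace, whose size is `Bin(n, η)`-distributed; and
`shown` is the labelled sample given to the learner, which outside `J` consists of the original
points with their correct labels. Otherwise `J` and the examples at the positions in `J` are
arbitrary: they may depend on the whole original sample and on additional randomness. -/
structure IsNastySample {Ω : Type v} [MeasurableSpace Ω] (P : Measure Ω) (D : Measure X)
    (g : X → Bool) (η : unitInterval) {n : ℕ} (clean : Ω → Fin n → X) (J : Ω → Finset (Fin n))
    (shown : Ω → Fin n → X × Bool) : Prop where
  hasLaw_clean : HasLaw clean (Measure.pi fun _ : Fin n => D) P
  hasLaw_card : HasLaw (fun ω => (J ω).card) (binomial n η) P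
  unchanged : ∀ᵐ ω ∂P, ∀ i, i ∉ J ω → shown ω i = (clean ω i, g (clean ω i))

/-- The learning algorithm `A`, which uses samples of size `n`, PAC learns the class `H` with
accuracy `ε` and confidence `δ` in the presence of nasty noise of rate `η`: its outputs belong to
`H`, and whatever the distribution `D`, the target `g` in `H` and the nasty adversary, the output
has error `< ε` except on an event of (outer) probability at most `δ`. -/
def NastyPACLearns (H : Set (X → Bool)) (η : unitInterval) (ε δ : ℝ) {n : ℕ}
    (A : (Fin n → X × Bool) → (X → Bool)) : Prop :=
  (∀ s, A s ∈ H) ∧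
  ∀ (D : Measure X) [IsProbabilityMeasure D], ∀ g ∈ H,
  ∀ (Ω : Type v) [MeasurableSpace Ω] (P : Measure Ω) [IsProbabilityMeasure P]
    (clean : Ω → Fin n → X) (J : Ω → Finset (Fin n)) (shown : Ω → Fin n → X × Bool),
    IsNastySample P D g η clean J shown →
      P {ω | ¬ D.real {x | A (shown ω) x ≠ g x} < ε} ≤ ENNReal.ofReal δ

end NastyNoise

/-! ### Sauer–Shelah and packing numbers of traces. -/

section Packing

variable {X : Type u} {H : Set (X → Bool)} {d : ℕ}

/-! The learner minimizes empirical error. The target errs only inside `J` on the shown sample, so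
the minimizer makes at most `|J|` errors there; adding the corrupted positions, it disagrees with
the target on at most `2|J|` original points (`disagreements_le_two_mul_card`). A Chernoff bound
gives `|J| < (η + Δ/4)n` with high probability, and uniform convergence on the clean sample at
precision `Δ/2` (`measure_exists_error_le`) turns this into true error below `2η + Δ`. Since that
bound covers all of `H` at once, it does not matter that the adversary sees the sample.

A plain union bound over traces in the uniform convergence would cost an extra factor `log(1/Δ)`.
Chaining avoids it. Comparison with a ghost sample and random swaps reduces the problem to
Rademacher sums indexed by traces (`measure_exists_gap_le`). The traces are approximated by nets at
scales `4⁻ʲ`, whose sizes are bounded independently of `n` (`card_separated_le`), and Hoeffding's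
inequality is applied to each link of the chain (`card_exists_signedGap_le`). -/

theorem ClassShatters.card_le {T : Finset X} (hT : ClassShatters H T)
    (hd : classVCDim H = (d : ℕ∞)) : T.card ≤ d := by
  have : (T.card : ℕ∞) ≤ classVCDim H :=
    le_iSup₂ (f := fun (T : Finset X) (_ : ClassShatters H T) => (T.card : ℕ∞)) T hT
  rw [hd] at this
  exact_mod_cast this

/-- A point where two members differ is shattered. The bound gives `d + log(1/δ) ≥ 1`, which absorbs
the absolute constants in later estimates. -/
theorem one_le_of_classVCDim_eq (hH : H.Nontrivial) (hd : classVCDim H = (d : ℕ∞)) : 1 ≤ d := by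
  obtain ⟨f, hf, g, hg, hfg⟩ := hH
  obtain ⟨x, hx⟩ := Function.ne_iff.mp hfg
  have hs : ClassShatters H {x} := by
    intro l
    by_cases h : f x = l x
    · exact ⟨f, hf, by simpa using h⟩
    · refine ⟨g, hg, ?_⟩
      simp only [Finset.mem_singleton, forall_eq]
      revert h hx
      cases f x <;> cases g x <;> cases l x <;> simp
  simpa using hs.card_le hd

/-- **Sauer–Shelah lemma** for the traces of a class on a finite family of points. -/
theorem card_traces_le_sum_choose (hd : classVCDim H = (d : ℕ∞)) {κ : Type*} [Fintype κ]
    (x : κ → X) (T : Finset (κ → Bool)) (hT : ∀ t ∈ T, ∃ h ∈ H, h ∘ x = t) :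
    T.card ≤ ∑ k ∈ Finset.Iic d, (Fintype.card κ).choose k := by
  classical
  set 𝒜 : Finset (Finset κ) := T.image fun t => Finset.univ.filter fun i => t i = true with h𝒜
  have hcard : 𝒜.card = T.card := by
    refine Finset.card_image_of_injective _ fun s t hst => ?_
    ext i
    have := Finset.ext_iff.mp hst i
    simp only [Finset.mem_filter, Finset.mem_univ, true_and] at this
    exact Bool.eq_iff_iff.mpr this ▸ rfl
  have hvc : 𝒜.vcDim ≤ d := by
    refine Finset.sup_le fun S hS => ?_
    rw [Finset.mem_shatterer] at hS
    have key : ∀ l : κ → Bool, ∃ h ∈ H, ∀ i ∈ S, h (x i) = l i := by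
      intro l
      obtain ⟨A, hA, hAS⟩ := hS (Finset.filter_subset (fun i => l i = true) S)
      obtain ⟨t, ht, rfl⟩ := Finset.mem_image.mp hA
      obtain ⟨h, hh, rfl⟩ := hT t ht
      refine ⟨h, hh, fun i hi => ?_⟩
      have := Finset.ext_iff.mp hAS i
      simp only [Finset.mem_inter, hi, Finset.mem_filter, Finset.mem_univ, true_and,
        Function.comp_apply] at this
      exact Bool.eq_iff_iff.mpr this
    -- Two indices carrying the same point cannot receive different labels, so a shattered index set
    -- consists of distinct points.
    have hinj : Set.InjOn x S := by
      intro a ha b hb hab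
      by_contra hne
      obtain ⟨h, -, hl⟩ := key fun i => decide (i = a)
      have h1 := hl a ha
      have h2 := hl b hb
      rw [hab, h2] at h1
      simp [Ne.symm hne] at h1
    rw [← Finset.card_image_of_injOn hinj]
    refine ClassShatters.card_le (H := H) (fun l => ?_) hd
    obtain ⟨h, hh, hl⟩ := key fun i => l (x i)
    exact ⟨h, hh, by simpa using hl⟩
  rw [← hcard]
  refine (Finset.card_le_card_shatterer 𝒜).trans
    (Finset.card_shatterer_le_sum_vcDim.trans ?_)
  exact Finset.sum_le_sum_of_subset (Finset.Iic_subset_Iic.mpr hvc)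

/-- For `y ≤ 1` and `k ≤ d` one has `y ^ d ≤ y ^ k`, so the left side is dominated by the binomial
expansion of `(1 + y) ^ s`. Leaving `y` free allows it to be matched to the separation `ρ` later. -/
theorem pow_mul_sum_choose_le {y : ℝ} (hy0 : 0 ≤ y) (hy1 : y ≤ 1) (s d : ℕ) :
    y ^ d * ∑ k ∈ Finset.Iic d, (s.choose k : ℝ) ≤ Real.exp (y * s) := by
  have h1 : y ^ d * ∑ k ∈ Finset.Iic d, (s.choose k : ℝ)
      ≤ ∑ k ∈ Finset.Iic d, y ^ k * (s.choose k : ℝ) := by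
    rw [Finset.mul_sum]
    refine Finset.sum_le_sum fun k hk => ?_
    exact mul_le_mul_of_nonneg_right
      (pow_le_pow_of_le_one hy0 hy1 (Finset.mem_Iic.mp hk)) (Nat.cast_nonneg _)
  have h2 : ∑ k ∈ Finset.Iic d, y ^ k * (s.choose k : ℝ)
      ≤ ∑ k ∈ Finset.range (max d s + 1), y ^ k * (s.choose k : ℝ) := by
    refine Finset.sum_le_sum_of_subset_of_nonneg (fun k hk => ?_) fun _ _ _ => by positivity
    rw [Finset.mem_Iic] at hk
    rw [Finset.mem_range]
    omega
  have h3 : ∑ k ∈ Finset.range (max d s + 1), y ^ k * (s.choose k : ℝ) = (y + 1) ^ s := by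
    rw [add_pow]
    symm
    simp only [one_pow, mul_one]
    refine Finset.sum_subset (fun k hk => ?_) fun k _ hk => ?_
    · rw [Finset.mem_range] at *
      omega
    · rw [Finset.mem_range] at hk
      rw [Nat.choose_eq_zero_of_lt (by omega)]
      simp
  calc _ ≤ (y + 1) ^ s := by linarith
    _ ≤ Real.exp y ^ s := by
      gcongr
      exact Real.add_one_le_exp y
    _ = _ := by rw [← Real.exp_nat_mul, mul_comm]

/-- A subsample of `s` points misses the set where `a` and `b` differ with probability at most
`exp (-ρ s)` if that set has density more than `ρ`. -/
theorem card_agree_le {ι : Type*} [Fintype ι] [DecidableEq ι] {ρ : ℝ} {a b : ι → Bool}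
    (hab : ρ * Fintype.card ι < hammingDist a b) (s : ℕ) :
    (((Finset.univ : Finset (Fin s → ι)).filter fun f => a ∘ f = b ∘ f).card : ℝ)
      ≤ (Fintype.card ι : ℝ) ^ s * Real.exp (-(ρ * s)) := by
  have hset : ((Finset.univ : Finset (Fin s → ι)).filter fun f => a ∘ f = b ∘ f)
      = Fintype.piFinset fun _ : Fin s => Finset.univ.filter fun i => a i = b i := by
    ext f
    simp [funext_iff]
  have hsum : ((Finset.univ.filter fun i => a i = b i).card : ℝ) + hammingDist a b
      = Fintype.card ι := by
    unfold hammingDist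
    exact_mod_cast Finset.card_filter_add_card_filter_not (s := Finset.univ) fun i => a i = b i
  rw [hset, Fintype.card_piFinset]
  simp only [Finset.prod_const, Finset.card_univ, Fintype.card_fin, Nat.cast_pow]
  have hle : ((Finset.univ.filter fun i => a i = b i).card : ℝ)
      ≤ Fintype.card ι * Real.exp (-ρ) := by
    have := Real.add_one_le_exp (-ρ)
    nlinarith [Nat.cast_nonneg (α := ℝ) (Fintype.card ι)]
  calc _ ≤ ((Fintype.card ι : ℝ) * Real.exp (-ρ)) ^ s := by gcongr
    _ = _ := by
      rw [mul_pow, ← Real.exp_nat_mul]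
      ring_nf

/-- Dudley's packing bound: a `ρ`-separated set of traces of a class of VC-dimension `d` has at
most `2 (16 / ρ²) ^ d` elements. -/
theorem card_separated_le (hd : classVCDim H = (d : ℕ∞)) {ι : Type*} [Fintype ι]
    (x : ι → X) (T : Finset (ι → Bool)) (hT : ∀ t ∈ T, ∃ h ∈ H, h ∘ x = t)
    {ρ : ℝ} (hρ0 : 0 < ρ) (hρ1 : ρ ≤ 1)
    (hsep : ∀ a ∈ T, ∀ b ∈ T, a ≠ b → ρ * Fintype.card ι < hammingDist a b) :
    (T.card : ℝ) ≤ 2 * (16 / ρ ^ 2) ^ d := by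
  classical
  have hbase : 1 ≤ 16 / ρ ^ 2 := by
    rw [le_div_iff₀ (by positivity)]
    nlinarith
  rcases Nat.lt_or_ge T.card 2 with hM | hM
  · have h1 : (T.card : ℝ) ≤ 1 := by exact_mod_cast Nat.le_of_lt_succ hM
    have := one_le_pow₀ hbase (n := d)
    linarith
  obtain ⟨a₀, ha₀, b₀, hb₀, hab₀⟩ := Finset.one_lt_card.mp hM
  have hm : 0 < (Fintype.card ι : ℝ) := by
    have hne : Nonempty ι := by
      by_contra h
      rw [not_nonempty_iff] at h
      exact hab₀ (Subsingleton.elim _ _)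
    exact_mod_cast Fintype.card_pos
  have hM0 : (0 : ℝ) < T.card := by
    have : 0 < T.card := by omega
    exact_mod_cast this
  set L := Real.log T.card with hL
  have hexpL : Real.exp L = T.card := Real.exp_log hM0
  have hL0 : 0 ≤ L := Real.log_nonneg (by exact_mod_cast (by omega : 1 ≤ T.card))
  -- With `ρ s ≥ 2 log |T|`, a random subsample fails to separate a given pair with probability at
  -- most `|T|⁻²`, while there are fewer than `|T|²` ordered pairs.
  set s := ⌈2 * L / ρ⌉₊ with hs
  have hs1 : 2 * L ≤ ρ * s := by
    have := Nat.le_ceil (2 * L / ρ)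
    rw [div_le_iff₀ hρ0] at this
    linarith
  have hs2 : ρ * s ≤ 2 * L + 1 := by
    have := (Nat.ceil_lt_add_one (a := 2 * L / ρ) (by positivity)).le
    have h2 : ρ * s ≤ ρ * (2 * L / ρ + 1) := by gcongr
    have h3 : ρ * (2 * L / ρ + 1) = 2 * L + ρ := by field_simp
    linarith
  -- Probabilistic method: by the union bound, some subsample of `s` points already distinguishes
  -- all of `T`.
  obtain ⟨f, hf⟩ : ∃ f : Fin s → ι, ∀ a ∈ T, ∀ b ∈ T, a ∘ f = b ∘ f → a = b := by
    by_contra! hcon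
    have hcover : (Finset.univ : Finset (Fin s → ι)) ⊆
        T.offDiag.biUnion fun p => Finset.univ.filter fun f => p.1 ∘ f = p.2 ∘ f := by
      intro f _
      obtain ⟨a, ha, b, hb, hfab, hab⟩ := hcon f
      simp only [Finset.mem_biUnion, Finset.mem_offDiag, Finset.mem_filter, Finset.mem_univ,
        true_and]
      exact ⟨(a, b), ⟨ha, hb, hab⟩, hfab⟩
    have hle := (Finset.card_le_card hcover).trans Finset.card_biUnion_le
    have hle' : (Fintype.card ι : ℝ) ^ s ≤
        ∑ p ∈ T.offDiag, (Fintype.card ι : ℝ) ^ s * Real.exp (-(ρ * s)) := by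
      calc (Fintype.card ι : ℝ) ^ s = ((Finset.univ : Finset (Fin s → ι)).card : ℝ) := by simp
        _ ≤ ∑ p ∈ T.offDiag,
            (((Finset.univ : Finset (Fin s → ι)).filter fun f => p.1 ∘ f = p.2 ∘ f).card : ℝ) := by
          exact_mod_cast hle
        _ ≤ _ := by
          refine Finset.sum_le_sum fun p hp => ?_
          obtain ⟨h1, h2, h3⟩ := Finset.mem_offDiag.mp hp
          exact card_agree_le (hsep _ h1 _ h2 h3) s
    rw [Finset.sum_const, nsmul_eq_mul, Finset.offDiag_card] at hle'
    have hcardlt : ((T.card * T.card - T.card : ℕ) : ℝ) < Real.exp L * Real.exp L := by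
      rw [hexpL]
      have : T.card * T.card - T.card < T.card * T.card := Nat.sub_lt (by positivity) (by omega)
      exact_mod_cast this
    have hexp : Real.exp (-(ρ * s)) * (Real.exp L * Real.exp L) ≤ 1 := by
      rw [← Real.exp_add, ← Real.exp_add]
      exact Real.exp_le_one_iff.mpr (by linarith)
    have hp : 0 < (Fintype.card ι : ℝ) ^ s := by positivity
    have hE := Real.exp_pos (-(ρ * s))
    have : ((T.card * T.card - T.card : ℕ) : ℝ) * Real.exp (-(ρ * s)) < 1 := by nlinarith
    nlinarith
  have hinj : Set.InjOn (fun t : ι → Bool => t ∘ f) T := fun a ha b hb hab => hf a ha b hb hab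
  have hcard := card_traces_le_sum_choose hd (x ∘ f) (T.image fun t => t ∘ f) (by
    intro t ht
    obtain ⟨t', ht', rfl⟩ := Finset.mem_image.mp ht
    obtain ⟨h, hh, rfl⟩ := hT t' ht'
    exact ⟨h, hh, rfl⟩)
  rw [Finset.card_image_of_injOn hinj, Fintype.card_fin] at hcard
  have hcard' : (T.card : ℝ) ≤ ∑ k ∈ Finset.Iic d, (s.choose k : ℝ) := by exact_mod_cast hcard
  -- Sauer–Shelah on the subsample bounds `|T|` in terms of `s`, hence of `log |T|`. The choice `y =
  -- ρ/4` makes the right side a constant times `√|T|`, so the inequality can be solved for `|T|`.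
  have hmain : (ρ / 4) ^ d * T.card ≤ Real.exp (L / 2 + 1 / 4) := by
    calc (ρ / 4) ^ d * (T.card : ℝ)
        ≤ (ρ / 4) ^ d * ∑ k ∈ Finset.Iic d, (s.choose k : ℝ) := by gcongr
      _ ≤ Real.exp (ρ / 4 * s) := pow_mul_sum_choose_le (by positivity) (by linarith) s d
      _ ≤ _ := Real.exp_le_exp.mpr (by linarith)
  have hhalf : (ρ / 4) ^ d * Real.exp (L / 2) ≤ Real.exp (1 / 4) := by
    have h1 : (T.card : ℝ) = Real.exp (L / 2) * Real.exp (L / 2) := by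
      rw [← Real.exp_add, ← hexpL]
      ring_nf
    rw [h1, Real.exp_add] at hmain
    have := Real.exp_pos (L / 2)
    refine le_of_mul_le_mul_right (a := Real.exp (L / 2)) ?_ this
    linarith
  have hsq : ((ρ / 4) ^ d) ^ 2 * T.card ≤ 2 := by
    have h1 : (T.card : ℝ) = Real.exp (L / 2) ^ 2 := by
      rw [← Real.exp_nat_mul, ← hexpL]
      push_cast
      ring_nf
    have h2 : Real.exp (1 / 4) ^ 2 ≤ 2 := by
      have h4 : Real.exp (1 / 4) ^ 4 = Real.exp 1 := by
        rw [← Real.exp_nat_mul]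
        norm_num
      have := Real.exp_one_lt_d9
      nlinarith [sq_nonneg (Real.exp (1 / 4)), Real.exp_pos (1 / 4)]
    rw [h1, ← mul_pow]
    exact (pow_le_pow_left₀ (by positivity) hhalf 2).trans h2
  have hinv : ((ρ / 4) ^ d) ^ 2 * (16 / ρ ^ 2) ^ d = 1 := by
    rw [← pow_mul, mul_comm d 2, pow_mul, ← mul_pow]
    have : (ρ / 4) ^ 2 * (16 / ρ ^ 2) = 1 := by
      field_simp
      norm_num
    rw [this, one_pow]
  have hpos : 0 < ((ρ / 4) ^ d) ^ 2 := by positivity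
  refine le_of_mul_le_mul_left (a := ((ρ / 4) ^ d) ^ 2) ?_ hpos
  nlinarith

/-- Maximal separated sets are nets. -/
theorem exists_separated_net {ι : Type*} [Fintype ι] (U : Finset (ι → Bool)) {r : ℝ}
    (hr : 0 ≤ r) :
    ∃ T ⊆ U, (∀ a ∈ T, ∀ b ∈ T, a ≠ b → r < hammingDist a b) ∧
      ∀ u ∈ U, ∃ t ∈ T, (hammingDist u t : ℝ) ≤ r := by
  classical
  set F := U.powerset.filter fun T => ∀ a ∈ T, ∀ b ∈ T, a ≠ b → r < hammingDist a b with hF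
  obtain ⟨T, hT, hmax⟩ := F.exists_max_image Finset.card ⟨∅, by simp [hF]⟩
  simp only [hF, Finset.mem_filter, Finset.mem_powerset] at hT hmax
  refine ⟨T, hT.1, hT.2, fun u hu => ?_⟩
  by_contra! hcon
  have huT : u ∉ T := fun h => by
    have := hcon u h
    simp only [hammingDist_self, Nat.cast_zero] at this
    linarith
  have := hmax (insert u T) ⟨Finset.insert_subset hu hT.1, ?_⟩
  · rw [Finset.card_insert_of_notMem huT] at this
    omega
  · intro a ha b hb hab
    rcases Finset.mem_insert.mp ha with rfl | ha' <;> rcases Finset.mem_insert.mp hb with rfl | hb'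
    · exact absurd rfl hab
    · exact hcon b hb'
    · rw [hammingDist_comm]
      exact hcon a ha'
    · exact hT.2 a ha' b hb' hab

end Packing

/-! ### Rademacher sums and chaining. -/

section Chaining

/-- The Rademacher sign `±1` attached to a boolean. -/
def boolSign (b : Bool) : ℝ := if b then 1 else -1

/-- The sum over signs factors over coordinates, and each factor is `2 cosh x ≤ 2 exp (x² / 2)`. -/
theorem sum_exp_boolSign_le {n : ℕ} (c : Fin n → ℝ) (t : ℝ) :
    ∑ σ : Fin n → Bool, Real.exp (t * ∑ i, boolSign (σ i) * c i)
      ≤ 2 ^ n * Real.exp (t ^ 2 / 2 * ∑ i, c i ^ 2) := by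
  have h1 : ∀ σ : Fin n → Bool, Real.exp (t * ∑ i, boolSign (σ i) * c i)
      = ∏ i, Real.exp (t * (boolSign (σ i) * c i)) := fun σ => by
    rw [Finset.mul_sum, Real.exp_sum]
  simp_rw [h1]
  have h2 := Finset.prod_univ_sum (fun _ : Fin n => (Finset.univ : Finset Bool))
    fun i b => Real.exp (t * (boolSign b * c i))
  rw [Fintype.piFinset_univ] at h2
  rw [← h2]
  have h3 : ∀ i, ∑ b : Bool, Real.exp (t * (boolSign b * c i))
      ≤ 2 * Real.exp (t ^ 2 / 2 * c i ^ 2) := fun i => by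
    have := Real.cosh_le_exp_half_sq (t * c i)
    rw [Real.cosh_eq] at this
    have h4 : (t * c i) ^ 2 / 2 = t ^ 2 / 2 * c i ^ 2 := by ring
    rw [h4] at this
    simp only [Fintype.sum_bool, boolSign, if_true, Bool.false_eq_true, if_false, one_mul,
      neg_mul, mul_neg]
    linarith
  calc _ ≤ ∏ i, 2 * Real.exp (t ^ 2 / 2 * c i ^ 2) :=
        Finset.prod_le_prod (fun i _ => Finset.sum_nonneg fun b _ => (Real.exp_pos _).le)
          fun i _ => h3 i
    _ = _ := by
      rw [Finset.prod_mul_distrib, ← Real.exp_sum, ← Finset.mul_sum]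
      simp

theorem card_signs_lt_le {n : ℕ} (c : Fin n → ℝ) {lam W : ℝ} (hlam : 0 ≤ lam) (hW : 0 < W)
    (hc : ∑ i, c i ^ 2 ≤ W) :
    ((Finset.univ.filter fun σ : Fin n → Bool => lam < ∑ i, boolSign (σ i) * c i).card : ℝ)
      ≤ 2 ^ n * Real.exp (-(lam ^ 2 / (2 * W))) := by
  -- The minimizer of `t² W / 2 - t lam`.
  set t := lam / W with ht
  have ht0 : 0 ≤ t := by positivity
  have h1 : ((Finset.univ.filter fun σ : Fin n → Bool => lam < ∑ i, boolSign (σ i) * c i).card : ℝ)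
      * Real.exp (t * lam) ≤ 2 ^ n * Real.exp (t ^ 2 / 2 * W) := by
    rw [← nsmul_eq_mul, ← Finset.sum_const]
    calc _ ≤ ∑ σ ∈ Finset.univ.filter fun σ : Fin n → Bool => lam < ∑ i, boolSign (σ i) * c i,
          Real.exp (t * ∑ i, boolSign (σ i) * c i) := by
          refine Finset.sum_le_sum fun σ hσ => ?_
          have := (Finset.mem_filter.mp hσ).2.le
          gcongr
      _ ≤ ∑ σ : Fin n → Bool, Real.exp (t * ∑ i, boolSign (σ i) * c i) :=
          Finset.sum_le_sum_of_subset_of_nonneg (Finset.filter_subset _ _)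
            fun _ _ _ => (Real.exp_pos _).le
      _ ≤ _ := sum_exp_boolSign_le c t
      _ ≤ _ := by gcongr
  have h2 : Real.exp (t ^ 2 / 2 * W) = Real.exp (-(lam ^ 2 / (2 * W))) * Real.exp (t * lam) := by
    rw [← Real.exp_add]
    congr 1
    rw [ht]
    field_simp
    ring
  rw [h2, ← mul_assoc] at h1
  exact le_of_mul_le_mul_right h1 (Real.exp_pos _)

/-- **Hoeffding's inequality** for Rademacher sums, in counting form. -/
theorem card_signs_lt_abs_le {n : ℕ} (c : Fin n → ℝ) {lam W : ℝ} (hlam : 0 ≤ lam) (hW : 0 < W)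
    (hc : ∑ i, c i ^ 2 ≤ W) :
    ((Finset.univ.filter fun σ : Fin n → Bool => lam < |∑ i, boolSign (σ i) * c i|).card : ℝ)
      ≤ 2 ^ n * (2 * Real.exp (-(lam ^ 2 / (2 * W)))) := by
  classical
  have h1 := card_signs_lt_le c hlam hW hc
  have h2 := card_signs_lt_le (fun i => -c i) hlam hW (by simpa using hc)
  have hsub : (Finset.univ.filter fun σ : Fin n → Bool => lam < |∑ i, boolSign (σ i) * c i|) ⊆
      (Finset.univ.filter fun σ : Fin n → Bool => lam < ∑ i, boolSign (σ i) * c i) ∪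
      (Finset.univ.filter fun σ : Fin n → Bool => lam < ∑ i, boolSign (σ i) * (-c i)) := by
    intro σ
    simp only [Finset.mem_union, Finset.mem_filter, Finset.mem_univ, true_and, mul_neg,
      Finset.sum_neg_distrib]
    exact lt_abs.mp
  have h3 := (Finset.card_le_card hsub).trans (Finset.card_union_le _ _)
  have h4 : ((Finset.univ.filter fun σ : Fin n → Bool =>
      lam < |∑ i, boolSign (σ i) * c i|).card : ℝ) ≤
      (Finset.univ.filter fun σ : Fin n → Bool => lam < ∑ i, boolSign (σ i) * c i).card +
      (Finset.univ.filter fun σ : Fin n → Bool => lam < ∑ i, boolSign (σ i) * (-c i)).card := by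
    exact_mod_cast h3
  linarith

/-- The signed difference between the disagreements of `w` with `v` on the two halves of a
double sample. -/
def signedGap {n : ℕ} (v w : Fin n ⊕ Fin n → Bool) (σ : Fin n → Bool) : ℝ :=
  ∑ i, boolSign (σ i) * ((if w (.inl i) ≠ v (.inl i) then 1 else 0) -
    (if w (.inr i) ≠ v (.inr i) then 1 else 0))

theorem signedGap_self {n : ℕ} (v : Fin n ⊕ Fin n → Bool) (σ : Fin n → Bool) :
    signedGap v v σ = 0 := by
  simp [signedGap]

/-- An increment is a Rademacher sum whose `i`-th coefficient is at most `m` in absolute value,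
where `m ≤ 2` counts the points of the `i`-th pair at which `a` and `b` differ. As `m² ≤ 2m`, the
variance is controlled by the Hamming distance. -/
theorem card_signedGap_sub_le {n : ℕ} (v a b : Fin n ⊕ Fin n → Bool) {lam W : ℝ}
    (hlam : 0 ≤ lam) (hW : 0 < W) (hab : 2 * (hammingDist b a : ℝ) ≤ W) :
    ((Finset.univ.filter fun σ : Fin n → Bool =>
      lam < |signedGap v b σ - signedGap v a σ|).card : ℝ)
      ≤ 2 ^ n * (2 * Real.exp (-(lam ^ 2 / (2 * W)))) := by
  set c : Fin n → ℝ := fun i => ((if b (.inl i) ≠ v (.inl i) then 1 else 0) -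
    (if b (.inr i) ≠ v (.inr i) then 1 else 0)) - ((if a (.inl i) ≠ v (.inl i) then 1 else 0) -
    (if a (.inr i) ≠ v (.inr i) then 1 else 0)) with hc
  have hgap : ∀ σ, signedGap v b σ - signedGap v a σ = ∑ i, boolSign (σ i) * c i := fun σ => by
    simp only [signedGap, hc, ← Finset.sum_sub_distrib, ← mul_sub]
  simp_rw [hgap]
  refine card_signs_lt_abs_le c hlam hW (le_trans ?_ hab)
  have hham : (hammingDist b a : ℝ) = ∑ i : Fin n, ((if b (.inl i) ≠ a (.inl i) then 1 else 0) +
      (if b (.inr i) ≠ a (.inr i) then 1 else 0)) := by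
    unfold hammingDist
    rw [Finset.card_filter]
    push_cast
    rw [Fintype.sum_sum_type, Finset.sum_add_distrib]
  rw [hham, Finset.mul_sum]
  refine Finset.sum_le_sum fun i _ => ?_
  simp only [hc]
  generalize b (.inl i) = b₁, b (.inr i) = b₂, a (.inl i) = a₁, a (.inr i) = a₂,
    v (.inl i) = v₁, v (.inr i) = v₂
  cases b₁ <;> cases b₂ <;> cases a₁ <;> cases a₂ <;> cases v₁ <;> cases v₂ <;> norm_num

/-- The link thresholds thus add up to less than `4`, the factor in front of the square root in
`card_exists_signedGap_le`. -/
theorem sum_chain_weights (L : ℕ) :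
    ∑ j ∈ Finset.range L, ((j : ℝ) + 1) / 2 ^ j = 4 - 2 * (L + 2) / 2 ^ L := by
  induction L with
  | zero => norm_num
  | succ L ih =>
    rw [Finset.sum_range_succ, ih, pow_succ]
    field_simp
    push_cast
    ring

theorem sum_half_pow_succ (L : ℕ) :
    ∑ j ∈ Finset.range L, (1 / 2 : ℝ) ^ (j + 1) = 1 - (1 / 2) ^ L := by
  induction L with
  | zero => norm_num
  | succ L ih =>
    rw [Finset.sum_range_succ, ih, pow_succ]
    ring

variable {X : Type u} {H : Set (X → Bool)} {d : ℕ}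

/-- Nets of the traces of `H` on a finite family of points at the scales `4⁻ʲ`, starting from a
single trace, with Dudley's bound on their sizes. -/
theorem exists_chain (hd : classVCDim H = (d : ℕ∞)) {ι : Type*} [Fintype ι]
    (x : ι → X) {g : X → Bool} (hg : g ∈ H) :
    ∃ T : ℕ → Finset (ι → Bool), T 0 = {g ∘ x} ∧
      (∀ j, ((T (j + 1)).card : ℝ) ≤ 2 * (16 ^ (j + 2)) ^ d) ∧
      (∀ h ∈ H, ∀ j, ∃ t ∈ T j, (hammingDist (h ∘ x) t : ℝ) ≤ Fintype.card ι / 4 ^ j) ∧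
      ∀ j, ∀ b ∈ T (j + 1), ∃ a ∈ T j, (hammingDist b a : ℝ) ≤ Fintype.card ι / 4 ^ j := by
  classical
  set U : Finset (ι → Bool) := Finset.univ.filter fun t => ∃ h ∈ H, h ∘ x = t with hU
  choose N hNU hNsep hNnet using fun j : ℕ =>
    exists_separated_net U (r := (1 / 4 ^ j : ℝ) * Fintype.card ι) (by positivity)
  -- At scale `0` any single trace is a net. Taking that of `g` makes the signed gap vanish at the
  -- root of the chain.
  set T : ℕ → Finset (ι → Bool) := fun j => if j = 0 then {g ∘ x} else N j with hT
  have hTU : ∀ j, ∀ t ∈ T j, t ∈ U := by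
    intro j t ht
    rcases eq_or_ne j 0 with rfl | hj
    · simp only [hT, if_true, Finset.mem_singleton] at ht
      simp only [hU, Finset.mem_filter, Finset.mem_univ, true_and]
      exact ⟨g, hg, ht.symm⟩
    · simp only [hT, hj, if_false] at ht
      exact hNU j ht
  have hnet : ∀ j, ∀ w ∈ U, ∃ t ∈ T j, (hammingDist w t : ℝ) ≤ Fintype.card ι / 4 ^ j := by
    intro j w hw
    rcases eq_or_ne j 0 with rfl | hj
    · refine ⟨g ∘ x, by simp [hT], ?_⟩
      simpa using hammingDist_le_card_fintype (x := w) (y := g ∘ x)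
    · obtain ⟨t, ht, hwt⟩ := hNnet j w hw
      refine ⟨t, by simpa [hT, hj] using ht, hwt.trans_eq ?_⟩
      ring
  refine ⟨T, by simp [hT], fun j => ?_, fun h hh j => ?_,
    fun j b hb => hnet j b (hTU _ b hb)⟩
  · have h1 := card_separated_le hd x (N (j + 1))
      (fun t ht => (Finset.mem_filter.mp (hNU _ ht)).2) (ρ := 1 / 4 ^ (j + 1)) (by positivity)
      (by
        rw [div_le_one (by positivity)]
        exact one_le_pow₀ (by norm_num)) (hNsep (j + 1))
    have h2 : (16 / (1 / 4 ^ (j + 1)) ^ 2 : ℝ) = 16 ^ (j + 2) := by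
      have : (16 : ℝ) = 4 ^ 2 := by norm_num
      rw [this, one_div, inv_pow, div_inv_eq_mul, ← pow_mul, ← pow_mul, ← pow_add]
      congr 1
      ring
    rw [h2] at h1
    simpa [hT] using h1
  · refine hnet j (h ∘ x) ?_
    simp only [hU, Finset.mem_filter, Finset.mem_univ, true_and]
    exact ⟨h, hh, rfl⟩

/-- Net size times the failure probability of one link. The net costs at most `6(j+1)d` in the
exponent against a gain of `16(d + log(1/δ))(j+1)²`; the surplus is at least `10(j+1) + log(1/δ)`,
which pays for `δ` and a geometric factor. -/
theorem chain_term_le {δ : ℝ} (hδ0 : 0 < δ) (hδ1 : δ < 1) (hd1 : 1 ≤ d) (j : ℕ) :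
    2 * ((16 : ℝ) ^ (j + 2)) ^ d *
      (2 * Real.exp (-(16 * (d + Real.log (1 / δ)) * (j + 1) ^ 2))) ≤
      δ / 8 * (1 / 2) ^ (j + 1) := by
  set l := Real.log (1 / δ) with hl
  have hl0 : 0 ≤ l := Real.log_nonneg (by rw [le_div_iff₀ hδ0]; linarith)
  have hδ : Real.exp (-l) = δ := by
    rw [hl, one_div, Real.log_inv, neg_neg, Real.exp_log hδ0]
  have hd' : (1 : ℝ) ≤ d := by exact_mod_cast hd1
  have hj : (0 : ℝ) ≤ j := Nat.cast_nonneg j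
  have h16 : (16 : ℝ) ≤ Real.exp 3 := by
    have h1 : Real.exp 3 = Real.exp 1 ^ 3 := by
      rw [← Real.exp_nat_mul]
      norm_num
    rw [h1]
    have := Real.exp_one_gt_d9
    calc (16 : ℝ) ≤ 2.7 ^ 3 := by norm_num
      _ ≤ _ := by gcongr; linarith
  have hpow : ((16 : ℝ) ^ (j + 2)) ^ d ≤ Real.exp (6 * (j + 1) * d) := by
    calc ((16 : ℝ) ^ (j + 2)) ^ d ≤ (Real.exp 3 ^ (j + 2)) ^ d := by gcongr
      _ = Real.exp (d * (((j : ℝ) + 2) * 3)) := by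
        rw [← Real.exp_nat_mul, ← Real.exp_nat_mul]
        push_cast
        rfl
      _ ≤ _ := Real.exp_le_exp.mpr (by nlinarith)
  have hten : Real.exp (-(10 * (j + 1))) ≤ 1 / 32 * (1 / 2) ^ (j + 1) := by
    have h1 : Real.exp (-10) ≤ 1 / 64 := by
      rw [Real.exp_neg, one_div]
      refine inv_anti₀ (by norm_num) ?_
      have h1 : Real.exp 10 = Real.exp 1 ^ 10 := by
        rw [← Real.exp_nat_mul]
        norm_num
      rw [h1]
      have := Real.exp_one_gt_d9
      calc (64 : ℝ) ≤ 2 ^ 10 := by norm_num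
        _ ≤ _ := by gcongr; linarith
    have h2 : Real.exp (-(10 * (j + 1))) = Real.exp (-10) ^ (j + 1) := by
      rw [← Real.exp_nat_mul]
      push_cast
      ring_nf
    rw [h2]
    calc Real.exp (-10) ^ (j + 1) ≤ (1 / 64) ^ (j + 1) := by gcongr
      _ = (1 / 32) ^ (j + 1) * (1 / 2) ^ (j + 1) := by
        rw [← mul_pow]
        norm_num
      _ ≤ (1 / 32) ^ 1 * (1 / 2) ^ (j + 1) := by
        refine mul_le_mul_of_nonneg_right ?_ (by positivity)
        exact pow_le_pow_of_le_one (by norm_num) (by norm_num) (by omega)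
      _ = _ := by norm_num
  have hexp : Real.exp (6 * (j + 1) * d) * Real.exp (-(16 * (d + l) * (j + 1) ^ 2))
      ≤ Real.exp (-(10 * (j + 1))) * δ := by
    rw [← hδ, ← Real.exp_add, ← Real.exp_add]
    refine Real.exp_le_exp.mpr ?_
    have h1 : ((d : ℝ) + l) * (j + 1) ≤ (d + l) * (j + 1) ^ 2 := by
      have : (j : ℝ) + 1 ≤ (j + 1) ^ 2 := by nlinarith
      gcongr
    nlinarith [mul_nonneg hl0 hj, mul_nonneg (sub_nonneg.mpr hd') hj]
  have he := Real.exp_pos (-(16 * ((d : ℝ) + l) * (j + 1) ^ 2))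
  calc _ = 4 * (((16 : ℝ) ^ (j + 2)) ^ d * Real.exp (-(16 * (d + l) * (j + 1) ^ 2))) := by ring
    _ ≤ 4 * (Real.exp (6 * (j + 1) * d) * Real.exp (-(16 * (d + l) * (j + 1) ^ 2))) := by gcongr
    _ ≤ 4 * (Real.exp (-(10 * (j + 1))) * δ) := by gcongr
    _ ≤ 4 * (1 / 32 * (1 / 2) ^ (j + 1) * δ) := by gcongr
    _ = _ := by ring

/-- Dudley's chaining bound: for most choices of signs, all signed gaps of a class of
VC-dimension `d` are of order at most `√(n (d + log (1 / δ)))`. -/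
theorem card_exists_signedGap_le (hd : classVCDim H = (d : ℕ∞)) (hd1 : 1 ≤ d) {n : ℕ}
    (hn : 0 < n) (x : Fin n ⊕ Fin n → X) {g : X → Bool} (hg : g ∈ H) {δ : ℝ} (hδ0 : 0 < δ)
    (hδ1 : δ < 1) (S : Finset (Fin n → Bool))
    (hS : ∀ σ ∈ S, ∃ h ∈ H,
      4 * Real.sqrt (128 * n * (d + Real.log (1 / δ))) < |signedGap (g ∘ x) (h ∘ x) σ|) :
    (S.card : ℝ) ≤ 2 ^ n * (δ / 8) := by
  classical
  set Q := (d : ℝ) + Real.log (1 / δ) with hQ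
  have hQ0 : 0 ≤ Q :=
    add_nonneg (Nat.cast_nonneg _) (Real.log_nonneg (by rw [le_div_iff₀ hδ0]; linarith))
  set R := Real.sqrt (128 * n * Q) with hR
  have hR0 : 0 ≤ R := Real.sqrt_nonneg _
  have hRsq : R ^ 2 = 128 * n * Q := Real.sq_sqrt (by positivity)
  have hn' : (0 : ℝ) < n := by exact_mod_cast hn
  obtain ⟨T, hT0, hTcard, hTnet, hstep⟩ := exists_chain hd x hg
  have hcard : (Fintype.card (Fin n ⊕ Fin n) : ℝ) = 2 * n := by
    simp
    ring
  rw [hcard] at hTnet hstep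
  choose! π hπT hπ using hstep
  -- At depth `L` the net radius is below `1`, so the chain ends exactly at the trace of `h`.
  obtain ⟨L, hL⟩ : ∃ L : ℕ, (2 * n : ℝ) < 4 ^ L := pow_unbounded_of_one_lt _ (by norm_num)
  -- The factor `2⁻ʲ` matches the standard deviation of a link at scale `4⁻ʲ`; the factor `j + 1`
  -- outweighs the growth of the nets and keeps the sum finite.
  set lam : ℕ → ℝ := fun j => R * ((j + 1) / 2 ^ j) with hlam
  set B : ℕ → (Fin n ⊕ Fin n → Bool) → Finset (Fin n → Bool) := fun j b =>
    Finset.univ.filter fun σ => lam j < |signedGap (g ∘ x) b σ - signedGap (g ∘ x) (π j b) σ|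
    with hB
  have hcover : S ⊆ (Finset.range L).biUnion fun j => (T (j + 1)).biUnion (B j) := by
    intro σ hσ
    by_contra hcon
    simp only [Finset.mem_biUnion, Finset.mem_range, hB, Finset.mem_filter, Finset.mem_univ,
      true_and, not_exists, not_and, not_lt] at hcon
    -- If every link is good, the gap telescopes down the chain to the root, where it is `0`.
    have hind : ∀ j ≤ L, ∀ b ∈ T j,
        |signedGap (g ∘ x) b σ| ≤ ∑ i ∈ Finset.range j, lam i := by
      intro j
      induction j with
      | zero =>
        intro _ b hb
        rw [hT0, Finset.mem_singleton] at hb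
        simp [hb, signedGap_self]
      | succ j ih =>
        intro hj b hb
        have h1 := hcon j (by omega) b hb
        have h2 := ih (by omega) _ (hπT j b hb)
        rw [Finset.sum_range_succ]
        have h3 := abs_add_le (signedGap (g ∘ x) b σ - signedGap (g ∘ x) (π j b) σ)
          (signedGap (g ∘ x) (π j b) σ)
        rw [sub_add_cancel] at h3
        linarith
    obtain ⟨h, hh, hgap⟩ := hS σ hσ
    obtain ⟨t, ht, hdist⟩ := hTnet h hh L
    have heq : h ∘ x = t := by
      rw [← hammingDist_lt_one]
      have : (hammingDist (h ∘ x) t : ℝ) < 1 :=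
        hdist.trans_lt ((div_lt_one (by positivity)).mpr hL)
      exact_mod_cast this
    have hle := hind L le_rfl t ht
    have hsum : ∑ i ∈ Finset.range L, lam i ≤ 4 * R := by
      simp only [hlam, ← Finset.mul_sum, sum_chain_weights]
      have : (0 : ℝ) ≤ 2 * (L + 2) / 2 ^ L := by positivity
      nlinarith
    rw [heq] at hgap
    linarith
  have hBcard : ∀ j, ∀ b ∈ T (j + 1),
      ((B j b).card : ℝ) ≤ 2 ^ n * (2 * Real.exp (-(16 * Q * (j + 1) ^ 2))) := by
    intro j b hb
    have h1 := card_signedGap_sub_le (g ∘ x) (π j b) b (lam := lam j) (W := 4 * n / 4 ^ j)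
      (by positivity) (by positivity) (by
        have := hπ j b hb
        calc _ ≤ 2 * (2 * n / 4 ^ j : ℝ) := by gcongr
          _ = _ := by ring)
    have h2 : lam j ^ 2 / (2 * (4 * n / 4 ^ j)) = 16 * Q * (j + 1) ^ 2 := by
      have h4 : (4 : ℝ) ^ j = 2 ^ j * 2 ^ j := by
        rw [← mul_pow]
        norm_num
      simp only [hlam, mul_pow, hRsq, h4]
      field_simp
      ring
    rw [h2] at h1
    exact h1
  calc (S.card : ℝ)
      ≤ ∑ j ∈ Finset.range L, ∑ b ∈ T (j + 1), ((B j b).card : ℝ) := by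
        have h1 := (Finset.card_le_card hcover).trans Finset.card_biUnion_le
        have h2 : ∑ j ∈ Finset.range L, ((T (j + 1)).biUnion (B j)).card ≤
            ∑ j ∈ Finset.range L, ∑ b ∈ T (j + 1), (B j b).card :=
          Finset.sum_le_sum fun j _ => Finset.card_biUnion_le
        exact_mod_cast h1.trans h2
    _ ≤ ∑ j ∈ Finset.range L, ∑ b ∈ T (j + 1),
          2 ^ n * (2 * Real.exp (-(16 * Q * (j + 1) ^ 2))) :=
        Finset.sum_le_sum fun j _ => Finset.sum_le_sum fun b hb => hBcard j b hb
    _ ≤ ∑ j ∈ Finset.range L, 2 ^ n * (δ / 8 * (1 / 2) ^ (j + 1)) := by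
        refine Finset.sum_le_sum fun j _ => ?_
        rw [Finset.sum_const, nsmul_eq_mul]
        have h1 := hTcard j
        have h2 := chain_term_le hδ0 hδ1 hd1 j
        calc _ ≤ 2 * ((16 : ℝ) ^ (j + 2)) ^ d *
              (2 ^ n * (2 * Real.exp (-(16 * Q * (j + 1) ^ 2)))) := by gcongr
          _ = 2 ^ n * (2 * ((16 : ℝ) ^ (j + 2)) ^ d *
              (2 * Real.exp (-(16 * Q * (j + 1) ^ 2)))) := by ring
          _ ≤ _ := by gcongr
    _ = 2 ^ n * (δ / 8) * (1 - (1 / 2) ^ L) := by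
        rw [← sum_half_pow_succ, Finset.mul_sum]
        exact Finset.sum_congr rfl fun j _ => by ring
    _ ≤ 2 ^ n * (δ / 8) * 1 := by
        refine mul_le_mul_of_nonneg_left ?_ (by positivity)
        have : (0 : ℝ) ≤ (1 / 2) ^ L := by positivity
        linarith
    _ = _ := mul_one _

end Chaining

/-! ### Tail bounds, symmetrization and uniform convergence. -/

section UniformConvergence

variable {X : Type u}

/-- Swap the two components of a pair unless `b` holds. -/
def swapUnless (b : Bool) (p : X × X) : X × X := if b then p else p.swap

/-- Exchange the `i`-th points of the two samples whenever `σ i` is false. -/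
def swapSamples {n : ℕ} (σ : Fin n → Bool) (z : (Fin n → X) × (Fin n → X)) :
    (Fin n → X) × (Fin n → X) :=
  (fun i => (swapUnless (σ i) (z.1 i, z.2 i)).1, fun i => (swapUnless (σ i) (z.1 i, z.2 i)).2)

theorem disagreements_swapSamples_sub {n : ℕ} (h g : X → Bool) (σ : Fin n → Bool)
    (z : (Fin n → X) × (Fin n → X)) :
    (disagreements h g (swapSamples σ z).1 : ℝ) - disagreements h g (swapSamples σ z).2
      = signedGap (g ∘ Sum.elim z.1 z.2) (h ∘ Sum.elim z.1 z.2) σ := by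
  unfold disagreements signedGap
  rw [Finset.card_filter, Finset.card_filter]
  push_cast
  rw [← Finset.sum_sub_distrib]
  refine Finset.sum_congr rfl fun i _ => ?_
  simp only [swapSamples, swapUnless, boolSign, Function.comp_apply, Sum.elim_inl, Sum.elim_inr]
  by_cases hi : σ i = true <;> by_cases h₁ : h (z.1 i) = g (z.1 i) <;>
    by_cases h₂ : h (z.2 i) = g (z.2 i) <;> simp [hi, h₁, h₂]

/-- Follows from `|exp t - 1 - t| ≤ t²` for `|t| ≤ 1`, with `p t² ≤ t²`. -/
theorem bernoulli_mgf_le {p t : ℝ} (hp0 : 0 ≤ p) (hp1 : p ≤ 1) (ht : |t| ≤ 1) :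
    1 + (Real.exp t - 1) * p ≤ Real.exp (p * t + t ^ 2) := by
  have h1 := (abs_le.mp (Real.abs_exp_sub_one_sub_id_le ht)).2
  have h2 := Real.add_one_le_exp (p * t + t ^ 2)
  nlinarith [mul_le_mul_of_nonneg_right h1 hp0, sq_nonneg t]

variable [MeasurableSpace X] {H : Set (X → Bool)} {d : ℕ}

theorem measurePreserving_swapUnless (D : Measure X) [IsProbabilityMeasure D] (b : Bool) :
    MeasurePreserving (swapUnless b) (D.prod D) (D.prod D) := by
  cases b
  · exact Measure.measurePreserving_swap
  · exact MeasurePreserving.id _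

theorem measurePreserving_swapSamples (D : Measure X) [IsProbabilityMeasure D] {n : ℕ}
    (σ : Fin n → Bool) :
    MeasurePreserving (swapSamples σ)
      ((Measure.pi fun _ : Fin n => D).prod (Measure.pi fun _ : Fin n => D))
      ((Measure.pi fun _ : Fin n => D).prod (Measure.pi fun _ : Fin n => D)) := by
  have h1 := measurePreserving_arrowProdEquivProdArrow X X (Fin n) (fun _ => D) (fun _ => D)
  have h2 := measurePreserving_pi (fun _ : Fin n => D.prod D) (fun _ : Fin n => D.prod D)
    fun i => measurePreserving_swapUnless D (σ i)
  exact (h1.comp h2).comp (h1.symm _)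

theorem measurable_disagreements {h g : X → Bool} (hh : Measurable h) (hg : Measurable g) (n : ℕ) :
    Measurable fun x : Fin n → X => (disagreements h g x : ℝ) := by
  have hE : MeasurableSet {x | h x ≠ g x} := (measurableSet_eq_fun hh hg).compl
  have : (fun x : Fin n → X => (disagreements h g x : ℝ)) =
      fun x => ∑ i, {x | h x ≠ g x}.indicator (fun _ => (1 : ℝ)) (x i) := by
    funext x
    unfold disagreements
    rw [Finset.card_filter]
    push_cast
    exact Finset.sum_congr rfl fun i _ => by simp [Set.indicator_apply]
  rw [this]
  exact Finset.measurable_sum _ fun i _ =>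
    (measurable_const.indicator hE).comp (measurable_pi_apply i)

theorem integral_exp_disagreements (D : Measure X) [IsProbabilityMeasure D] {h g : X → Bool}
    (hh : Measurable h) (hg : Measurable g) (n : ℕ) (t : ℝ) :
    ∫ x : Fin n → X, Real.exp (t * disagreements h g x) ∂(Measure.pi fun _ => D)
      = (1 + (Real.exp t - 1) * D.real {x | h x ≠ g x}) ^ n := by
  set E := {x | h x ≠ g x} with hE'
  have hE : MeasurableSet E := (measurableSet_eq_fun hh hg).compl
  have h1 : ∀ x : Fin n → X, Real.exp (t * disagreements h g x) =
      ∏ i, (1 + (Real.exp t - 1) * E.indicator 1 (x i)) := by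
    intro x
    unfold disagreements
    rw [Finset.card_filter, Nat.cast_sum, Finset.mul_sum, Real.exp_sum]
    refine Finset.prod_congr rfl fun i _ => ?_
    by_cases hi : h (x i) = g (x i) <;> simp [hE', hi]
  simp_rw [h1]
  rw [integral_fintype_prod_eq_pow (fun x => 1 + (Real.exp t - 1) * E.indicator (1 : X → ℝ) x)]
  have hint : Integrable (E.indicator (1 : X → ℝ)) D := (integrable_const (1 : ℝ)).indicator hE
  rw [integral_add (integrable_const _) (hint.const_mul _), integral_const_mul,
    integral_indicator_one hE]
  simp

/-- Lower tail bound for the number of disagreements on an i.i.d. sample. -/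
theorem disagreements_lower_tail (D : Measure X) [IsProbabilityMeasure D] {h g : X → Bool}
    (hh : Measurable h) (hg : Measurable g) {n : ℕ} {τ : ℝ} (hτ0 : 0 ≤ τ) (hτ1 : τ ≤ 2) :
    (Measure.pi fun _ : Fin n => D).real
      {x | (disagreements h g x : ℝ) ≤ (D.real {x | h x ≠ g x} - τ) * n}
      ≤ Real.exp (-(n * τ ^ 2 / 4)) := by
  set p := D.real {x | h x ≠ g x} with hp
  have hint : Integrable (fun x : Fin n → X => Real.exp (-(τ / 2) * disagreements h g x))
      (Measure.pi fun _ => D) := by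
    refine Integrable.of_bound (((measurable_disagreements hh hg n).const_mul _).exp
      |>.aestronglyMeasurable) 1 (Filter.Eventually.of_forall fun x => ?_)
    rw [Real.norm_eq_abs, abs_of_pos (Real.exp_pos _)]
    refine Real.exp_le_one_iff.mpr ?_
    have : (0 : ℝ) ≤ disagreements h g x := Nat.cast_nonneg _
    nlinarith
  refine (measure_le_le_exp_mul_mgf _ (by linarith) hint).trans ?_
  rw [mgf, integral_exp_disagreements D hh hg, ← hp]
  have hp0 : 0 ≤ p := measureReal_nonneg
  have hp1 : p ≤ 1 := measureReal_le_one
  have hb := bernoulli_mgf_le hp0 hp1 (t := -(τ / 2)) (by rw [abs_neg, abs_of_nonneg] <;> linarith)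
  have hb0 : 0 ≤ 1 + (Real.exp (-(τ / 2)) - 1) * p := by
    nlinarith [mul_nonneg (Real.exp_pos (-(τ / 2))).le hp0]
  calc _ ≤ Real.exp (- -(τ / 2) * ((p - τ) * n)) * Real.exp (p * -(τ / 2) + (-(τ / 2)) ^ 2) ^ n := by
        gcongr
    _ = _ := by
        rw [← Real.exp_nat_mul, ← Real.exp_add]
        congr 1
        ring

/-- Upper tail bound for the binomial distribution. -/
theorem binomial_upper_tail (n : ℕ) (p : unitInterval) {τ : ℝ} (hτ0 : 0 ≤ τ) (hτ1 : τ ≤ 2) :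
    (binomial n p).real {k | ((p : ℝ) + τ) * n ≤ (k : ℝ)} ≤ Real.exp (-(n * τ ^ 2 / 4)) := by
  refine (measure_ge_le_exp_mul_mgf (X := fun k : ℕ => (k : ℝ)) (t := τ / 2) _ (by linarith)
    (integrable_binomial _)).trans ?_
  have hmgf : mgf (fun k : ℕ => (k : ℝ)) (binomial n p) (τ / 2)
      = (1 + (Real.exp (τ / 2) - 1) * p) ^ n := by
    rw [mgf, integral_binomial]
    have h1 : 1 + (Real.exp (τ / 2) - 1) * (p : ℝ) = p * Real.exp (τ / 2) + (1 - p) := by ring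
    rw [h1, add_pow]
    refine Finset.sum_congr ?_ fun k _ => ?_
    · ext k
      simp
    · rw [smul_eq_mul, mul_pow, ← Real.exp_nat_mul, mul_comm (τ / 2)]
      ring
  rw [hmgf]
  have hp0 : (0 : ℝ) ≤ p := p.2.1
  have hb := bernoulli_mgf_le hp0 p.2.2 (t := τ / 2) (by rw [abs_of_nonneg] <;> linarith)
  have hb0 : 0 ≤ 1 + (Real.exp (τ / 2) - 1) * (p : ℝ) := by
    nlinarith [mul_nonneg (Real.exp_pos (τ / 2)).le hp0, p.2.2]
  calc _ ≤ Real.exp (-(τ / 2) * ((p + τ) * n)) * Real.exp (p * (τ / 2) + (τ / 2) ^ 2) ^ n := by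
        gcongr
    _ = _ := by
        rw [← Real.exp_nat_mul, ← Real.exp_add]
        congr 1
        ring

theorem sqrt_chain_le {n Q ε : ℝ} (hε : 0 < ε) (hn : 0 ≤ n) (hnQ : 8192 * Q ≤ ε ^ 2 * n) :
    4 * Real.sqrt (128 * n * Q) ≤ ε * n / 2 := by
  have h1 : Real.sqrt (128 * n * Q) ≤ ε * n / 8 := by
    rw [Real.sqrt_le_left (by positivity)]
    nlinarith
  linarith

/-- Deviation bound for two independent samples. -/
theorem measure_exists_gap_le (hH : WellBehavedClass H) (hd : classVCDim H = (d : ℕ∞))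
    (hd1 : 1 ≤ d) (D : Measure X) [IsProbabilityMeasure D] {g : X → Bool} (hg : g ∈ H) {n : ℕ}
    {ε δ : ℝ} (hε : 0 < ε) (hδ0 : 0 < δ) (hδ1 : δ < 1) (hn0 : 0 < n)
    (hn : 8192 * (d + Real.log (1 / δ)) ≤ ε ^ 2 * n) :
    ((Measure.pi fun _ : Fin n => D).prod (Measure.pi fun _ : Fin n => D))
      {z | ∃ h ∈ H, ((⌊ε * n / 2⌋₊ : ℕ) : ℤ) <
        |(disagreements h g z.1 : ℤ) - (disagreements h g z.2 : ℤ)|}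
      ≤ ENNReal.ofReal (δ / 8) := by
  classical
  set μ := (Measure.pi fun _ : Fin n => D).prod (Measure.pi fun _ : Fin n => D) with hμ
  set B := {z : (Fin n → X) × (Fin n → X) | ∃ h ∈ H, ((⌊ε * n / 2⌋₊ : ℕ) : ℤ) <
        |(disagreements h g z.1 : ℤ) - (disagreements h g z.2 : ℤ)|} with hB
  have hBmeas : NullMeasurableSet B μ := hH.nullMeasurableSet D g hg n _
  have hpre : ∀ σ : Fin n → Bool, NullMeasurableSet (swapSamples σ ⁻¹' B) μ := fun σ =>
    hBmeas.preimage (measurePreserving_swapSamples D σ).quasiMeasurePreserving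
  have hpoint : ∀ z, ∑ σ : Fin n → Bool, (swapSamples σ ⁻¹' B).indicator (1 : (Fin n → X) × (Fin n → X) → ENNReal) z
      ≤ ENNReal.ofReal (2 ^ n * (δ / 8)) := by
    intro z
    have h1 : ∑ σ : Fin n → Bool, (swapSamples σ ⁻¹' B).indicator (1 : (Fin n → X) × (Fin n → X) → ENNReal) z
        = ((Finset.univ.filter fun σ : Fin n → Bool => swapSamples σ z ∈ B).card : ENNReal) := by
      rw [Finset.card_filter]
      push_cast
      exact Finset.sum_congr rfl fun σ _ => by simp [Set.indicator_apply]
    rw [h1, ← ENNReal.ofReal_natCast]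
    refine ENNReal.ofReal_le_ofReal ?_
    refine card_exists_signedGap_le hd hd1 hn0 (Sum.elim z.1 z.2) hg hδ0 hδ1 _ fun σ hσ => ?_
    obtain ⟨h, hh, hgap⟩ := (Finset.mem_filter.mp hσ).2
    refine ⟨h, hh, (sqrt_chain_le hε (Nat.cast_nonneg n) hn).trans_lt ?_⟩
    rw [← disagreements_swapSamples_sub]
    have h2 : ((⌊ε * n / 2⌋₊ : ℕ) : ℤ) + 1 ≤ |(disagreements h g (swapSamples σ z).1 : ℤ) -
      (disagreements h g (swapSamples σ z).2 : ℤ)| := hgap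
    have h3 : ((⌊ε * n / 2⌋₊ : ℕ) : ℝ) + 1 ≤ |(disagreements h g (swapSamples σ z).1 : ℝ) -
      (disagreements h g (swapSamples σ z).2 : ℝ)| := by exact_mod_cast h2
    exact (Nat.lt_floor_add_one _).trans_le h3
  have hsum : (2 ^ n : ENNReal) * μ B ≤ ENNReal.ofReal (2 ^ n * (δ / 8)) := by
    calc (2 ^ n : ENNReal) * μ B = ∑ σ : Fin n → Bool, μ (swapSamples σ ⁻¹' B) := by
          rw [Finset.sum_congr rfl fun σ _ =>
            (measurePreserving_swapSamples D σ).measure_preimage hBmeas]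
          simp [hμ]
      _ = ∑ σ : Fin n → Bool, ∫⁻ z, (swapSamples σ ⁻¹' B).indicator 1 z ∂μ :=
          Finset.sum_congr rfl fun σ _ => (lintegral_indicator_one₀ (hpre σ)).symm
      _ = ∫⁻ z, ∑ σ : Fin n → Bool, (swapSamples σ ⁻¹' B).indicator 1 z ∂μ :=
          (lintegral_finsetSum' _ fun σ _ => aemeasurable_const.indicator₀ (hpre σ)).symm
      _ ≤ ∫⁻ _, ENNReal.ofReal (2 ^ n * (δ / 8)) ∂μ := lintegral_mono hpoint
      _ = _ := by simp
  rw [ENNReal.ofReal_mul (by positivity), ENNReal.ofReal_pow (by norm_num),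
    ENNReal.ofReal_ofNat] at hsum
  exact (ENNReal.mul_le_mul_iff_right (by simp) (by simp)).mp hsum

/-- Uniform convergence at the rate `√((d + log (1 / δ)) / n)`, one-sided: with high probability
no hypothesis has an error exceeding its empirical error by `ε`. -/
theorem measure_exists_error_le (hH : WellBehavedClass H) (hd : classVCDim H = (d : ℕ∞))
    (hd1 : 1 ≤ d) (D : Measure X) [IsProbabilityMeasure D] {g : X → Bool} (hg : g ∈ H) {n : ℕ}
    {ε δ : ℝ} (hε : 0 < ε) (hε1 : ε ≤ 1) (hδ0 : 0 < δ) (hδ1 : δ < 1) (hn0 : 0 < n)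
    (hn : 8192 * (d + Real.log (1 / δ)) ≤ ε ^ 2 * n) :
    (Measure.pi fun _ : Fin n => D)
      {x | ∃ h ∈ H, (disagreements h g x : ℝ) + ε * n ≤ D.real {x | h x ≠ g x} * n}
      ≤ ENNReal.ofReal (δ / 4) := by
  set μ := Measure.pi fun _ : Fin n => D with hμ
  have hl0 : 0 ≤ Real.log (1 / δ) := Real.log_nonneg (by rw [le_div_iff₀ hδ0]; linarith)
  have hd' : (1 : ℝ) ≤ d := by exact_mod_cast hd1
  have hB := measure_exists_gap_le hH hd hd1 D hg hε hδ0 hδ1 hn0 hn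
  set B := {z : (Fin n → X) × (Fin n → X) | ∃ h ∈ H, ((⌊ε * n / 2⌋₊ : ℕ) : ℤ) <
        |(disagreements h g z.1 : ℤ) - (disagreements h g z.2 : ℤ)|} with hBdef
  set B' := toMeasurable (μ.prod μ) B with hB'
  have hB'meas : MeasurableSet B' := measurableSet_toMeasurable _ _
  have hsub : {x | ∃ h ∈ H, (disagreements h g x : ℝ) + ε * n ≤ D.real {x | h x ≠ g x} * n} ⊆
      {x | (2⁻¹ : ENNReal) ≤ μ (Prod.mk x ⁻¹' B')} := by
    rintro x ⟨h, hh, hx⟩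
    set p := D.real {x | h x ≠ g x} with hp
    have hhm := hH.measurable h hh
    have hgm := hH.measurable g hg
    set G := {y : Fin n → X | (disagreements h g y : ℝ) ≤ (p - ε / 2) * n} with hG
    have hGmeas : MeasurableSet G :=
      measurableSet_le (measurable_disagreements hhm hgm n) measurable_const
    have htail : μ.real G ≤ 2⁻¹ := by
      refine (disagreements_lower_tail D hhm hgm (n := n) (τ := ε / 2) (by linarith)
        (by linarith)).trans ?_
      calc Real.exp (-(n * (ε / 2) ^ 2 / 4)) ≤ Real.exp (-1) :=
            Real.exp_le_exp.mpr (by nlinarith)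
        _ ≤ 2⁻¹ := by
          rw [Real.exp_neg]
          have := Real.exp_one_gt_d9
          exact inv_anti₀ (by norm_num) (by linarith)
    have hcompl : (2⁻¹ : ENNReal) ≤ μ Gᶜ := by
      have h1 : (2⁻¹ : ℝ) ≤ μ.real Gᶜ := by
        rw [probReal_compl_eq_one_sub hGmeas]
        linarith
      have h2 := ENNReal.ofReal_le_ofReal h1
      rwa [ofReal_measureReal, ENNReal.ofReal_inv_of_pos (by norm_num), ENNReal.ofReal_ofNat] at h2
    refine hcompl.trans (measure_mono fun y hy => subset_toMeasurable _ _ ⟨h, hh, ?_⟩)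
    simp only [hG, Set.mem_compl_iff, Set.mem_ofPred_eq, not_le] at hy
    have h1 : ((⌊ε * n / 2⌋₊ : ℕ) : ℝ) ≤ ε * n / 2 := Nat.floor_le (by positivity)
    have h2 : ((⌊ε * n / 2⌋₊ : ℕ) : ℝ) <
        (disagreements h g y : ℝ) - (disagreements h g x : ℝ) := by linarith
    have h3 : ((⌊ε * n / 2⌋₊ : ℕ) : ℤ) <
        (disagreements h g y : ℤ) - (disagreements h g x : ℤ) := by exact_mod_cast h2
    rw [abs_sub_comm]
    exact h3.trans_le (le_abs_self _)
  have hmarkov : 2⁻¹ * μ {x | (2⁻¹ : ENNReal) ≤ μ (Prod.mk x ⁻¹' B')} ≤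
      ENNReal.ofReal (δ / 8) := by
    refine (mul_meas_ge_le_lintegral (measurable_measure_prodMk_left hB'meas) _).trans ?_
    rw [← Measure.prod_apply hB'meas, hB', measure_toMeasurable]
    exact hB
  refine (measure_mono hsub).trans ?_
  have h2 : ENNReal.ofReal (δ / 8) = 2⁻¹ * ENNReal.ofReal (δ / 4) := by
    rw [show δ / 8 = 2⁻¹ * (δ / 4) by ring, ENNReal.ofReal_mul (by norm_num),
      ENNReal.ofReal_inv_of_pos (by norm_num), ENNReal.ofReal_ofNat]
  rw [h2] at hmarkov
  exact (ENNReal.mul_le_mul_iff_right (by simp) (by simp)).mp hmarkov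

end UniformConvergence

section Learning

variable {X : Type u} {H : Set (X → Bool)} {d : ℕ}

/-- The number of examples of a labeled sample that are misclassified by `h`. -/
def sampleErrors {n : ℕ} (h : X → Bool) (s : Fin n → X × Bool) : ℕ :=
  (Finset.univ.filter fun i => h (s i).1 ≠ (s i).2).card

theorem exists_empirical_minimizer (hH : H.Nonempty) {n : ℕ} (s : Fin n → X × Bool) :
    ∃ h ∈ H, ∀ h' ∈ H, sampleErrors h s ≤ sampleErrors h' s := by
  have : Nonempty H := hH.to_subtype
  set m := Function.argmin fun h : H => sampleErrors h.1 s with hm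
  exact ⟨m.1, m.2, fun h' hh' => Function.argmin_le (fun h : H => sampleErrors h.1 s) ⟨h', hh'⟩⟩

/-- An empirical error minimizer on a corrupted sample disagrees with the target on at most twice
as many original points as were corrupted. -/
theorem disagreements_le_two_mul_card {n : ℕ} {h g : X → Bool} {x : Fin n → X}
    {s : Fin n → X × Bool} {J : Finset (Fin n)} (hs : ∀ i, i ∉ J → s i = (x i, g (x i)))
    (hmin : sampleErrors h s ≤ sampleErrors g s) : disagreements h g x ≤ 2 * J.card := by
  have hgJ : sampleErrors g s ≤ J.card := by
    refine Finset.card_le_card fun i hi => ?_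
    by_contra hiJ
    simp [hs i hiJ] at hi
  have hsub : (Finset.univ.filter fun i => h (x i) ≠ g (x i)) ⊆
      J ∪ Finset.univ.filter fun i => h (s i).1 ≠ (s i).2 := by
    intro i hi
    by_cases hiJ : i ∈ J
    · exact Finset.mem_union_left _ hiJ
    · refine Finset.mem_union_right _ ?_
      simpa [hs i hiJ] using hi
  have h1 := (Finset.card_le_card hsub).trans (Finset.card_union_le _ _)
  change disagreements h g x ≤ J.card + sampleErrors h s at h1
  omega

variable [MeasurableSpace X]

theorem nastyPACLearns_of_empirical_minimizer (hH : WellBehavedClass H)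
    (hd : classVCDim H = (d : ℕ∞)) (hd1 : 1 ≤ d) {η : unitInterval} {δ Δ : ℝ} (hδ0 : 0 < δ)
    (hδ1 : δ < 1) (hΔ0 : 0 < Δ) (hΔ1 : Δ ≤ 1) {n : ℕ} (hn0 : 0 < n)
    (hn : 32768 * (d + Real.log (1 / δ)) ≤ Δ ^ 2 * n)
    {A : (Fin n → X × Bool) → (X → Bool)} (hA : ∀ s, A s ∈ H)
    (hmin : ∀ s, ∀ h ∈ H, sampleErrors (A s) s ≤ sampleErrors h s) :
    NastyPACLearns.{u, v} H η (2 * (η : ℝ) + Δ) δ A := by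
  refine ⟨hA, fun D _ g hg Ω _ P _ clean J shown hS => ?_⟩
  have hl0 : 0 ≤ Real.log (1 / δ) := Real.log_nonneg (by rw [le_div_iff₀ hδ0]; linarith)
  have hd' : (1 : ℝ) ≤ d := by exact_mod_cast hd1
  set μ := Measure.pi fun _ : Fin n => D with hμ
  set bad := {x : Fin n → X | ∃ h ∈ H,
    (disagreements h g x : ℝ) + Δ / 2 * n ≤ D.real {x | h x ≠ g x} * n} with hbad
  have hbadle : μ bad ≤ ENNReal.ofReal (δ / 4) :=
    measure_exists_error_le hH hd hd1 D hg (by linarith) (by linarith) hδ0 hδ1 hn0 (by linarith)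
  have hclean : P {ω | clean ω ∈ toMeasurable μ bad} ≤ ENNReal.ofReal (δ / 4) := by
    rw [hS.hasLaw_clean.measure_eq (p := fun x => x ∈ toMeasurable μ bad)
      (measurableSet_toMeasurable _ _)]
    exact (measure_toMeasurable bad).trans_le hbadle
  have hJ : P {ω | ((η : ℝ) + Δ / 4) * n ≤ ((J ω).card : ℝ)} ≤ ENNReal.ofReal (δ / 2) := by
    rw [hS.hasLaw_card.measure_eq (p := fun k : ℕ => ((η : ℝ) + Δ / 4) * n ≤ (k : ℝ))
      MeasurableSet.of_discrete, ← ofReal_measureReal]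
    refine ENNReal.ofReal_le_ofReal ((binomial_upper_tail n η (by linarith) (by linarith)).trans ?_)
    have hexp : Real.exp (-Real.log (1 / δ)) = δ := by
      rw [one_div, Real.log_inv, neg_neg, Real.exp_log hδ0]
    calc Real.exp (-(n * (Δ / 4) ^ 2 / 4)) ≤ Real.exp (-1 + -Real.log (1 / δ)) :=
          Real.exp_le_exp.mpr (by nlinarith)
      _ = (Real.exp 1)⁻¹ * δ := by rw [Real.exp_add, hexp, Real.exp_neg]
      _ ≤ 2⁻¹ * δ := by
          have := Real.exp_one_gt_d9
          have : (Real.exp 1)⁻¹ ≤ 2⁻¹ := inv_anti₀ (by norm_num) (by linarith)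
          gcongr
      _ = δ / 2 := by ring
  have hsub : {ω | ¬ D.real {x | A (shown ω) x ≠ g x} < 2 * (η : ℝ) + Δ} ⊆
      ({ω | ((η : ℝ) + Δ / 4) * n ≤ ((J ω).card : ℝ)} ∪ {ω | clean ω ∈ toMeasurable μ bad}) ∪
      {ω | ¬ ∀ i, i ∉ J ω → shown ω i = (clean ω i, g (clean ω i))} := by
    intro ω hω
    by_contra hcon
    simp only [Set.mem_union, Set.mem_ofPred_eq, not_or, not_le, not_not] at hcon hω
    obtain ⟨⟨hJω, hcl⟩, hun⟩ := hcon
    refine hcl (subset_toMeasurable _ _ ⟨A (shown ω), hA _, ?_⟩)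
    have h1 := disagreements_le_two_mul_card hun (hmin _ g hg)
    have h2 : (disagreements (A (shown ω)) g (clean ω) : ℝ) ≤ 2 * (J ω).card := by
      exact_mod_cast h1
    have h3 : (2 * (η : ℝ) + Δ) * n ≤ D.real {x | A (shown ω) x ≠ g x} * n := by
      gcongr
      exact not_lt.mp hω
    linarith
  calc _ ≤ (P {ω | ((η : ℝ) + Δ / 4) * n ≤ ((J ω).card : ℝ)} +
        P {ω | clean ω ∈ toMeasurable μ bad}) +
        P {ω | ¬ ∀ i, i ∉ J ω → shown ω i = (clean ω i, g (clean ω i))} :=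
        (measure_mono hsub).trans ((measure_union_le _ _).trans
          (add_le_add_left (measure_union_le _ _) _))
    _ ≤ (ENNReal.ofReal (δ / 2) + ENNReal.ofReal (δ / 4)) + 0 := by
        gcongr
        exact (ae_iff.mp hS.unchanged).le
    _ ≤ ENNReal.ofReal δ := by
        rw [add_zero, ← ENNReal.ofReal_add (by linarith) (by linarith)]
        exact ENNReal.ofReal_le_ofReal (by linarith)

end Learning

theorem theorem4p5 :
    ∃ C : ℝ, 0 < C ∧
      ∀ (V : Type u) [MeasurableSpace (V × V × V)] (H : Set (V × V × V → Bool)),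
        WellBehavedClass H → H.Nontrivial →
        ∀ d : ℕ, classVCDim H = (d : ℕ∞) →
        ∀ (η : unitInterval) (δ Δ : ℝ), (η : ℝ) < 1 / 2 → 0 < δ → δ < 1 → 0 < Δ →
          ∃ N : ℕ, (N : ℝ) ≤ C / Δ ^ 2 * ((d : ℝ) + Real.log (1 / δ)) ∧
            ∀ n : ℕ, N ≤ n → ∃ A : (Fin n → (V × V × V) × Bool) → (V × V × V → Bool),
              NastyPACLearns.{u, v} H η (2 * (η : ℝ) + Δ) δ A := by
  refine ⟨65536, by norm_num, fun V _ H hH hnt d hd η δ Δ _ hδ0 hδ1 hΔ0 => ?_⟩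
  have hd1 := one_le_of_classVCDim_eq hnt hd
  have hd' : (1 : ℝ) ≤ d := by exact_mod_cast hd1
  have hl0 : 0 ≤ Real.log (1 / δ) := Real.log_nonneg (by rw [le_div_iff₀ hδ0]; linarith)
  set Q := (d : ℝ) + Real.log (1 / δ) with hQ
  have hQ1 : 1 ≤ Q := by linarith
  rcases lt_or_ge 1 Δ with hΔ1 | hΔ1
  · refine ⟨0, by rw [Nat.cast_zero]; positivity, fun n _ => ?_⟩
    obtain ⟨h, hh⟩ := hnt.nonempty
    refine ⟨fun _ => h, fun _ => hh, fun D _ g _ Ω _ P _ clean J shown _ => ?_⟩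
    have hempty : {ω : Ω | ¬ D.real {x | h x ≠ g x} < 2 * (η : ℝ) + Δ} = ∅ := by
      refine Set.eq_empty_of_forall_notMem fun ω hω => hω ?_
      have h1 : D.real {x | h x ≠ g x} ≤ 1 := measureReal_le_one
      have h2 : (0 : ℝ) ≤ η := η.2.1
      linarith
    rw [hempty, measure_empty]
    exact zero_le
  · have hΔsq : 0 < Δ ^ 2 := by positivity
    have hone : 1 ≤ 32768 * Q / Δ ^ 2 := by
      rw [le_div_iff₀ hΔsq]
      nlinarith
    refine ⟨⌈32768 * Q / Δ ^ 2⌉₊, ?_, fun n hn => ?_⟩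
    · have h1 := (Nat.ceil_lt_add_one (zero_le_one.trans hone)).le
      have h2 : 65536 / Δ ^ 2 * Q = 32768 * Q / Δ ^ 2 + 32768 * Q / Δ ^ 2 := by ring
      linarith
    · have hn' : 32768 * Q / Δ ^ 2 ≤ n := Nat.ceil_le.mp hn
      have hn0 : 0 < n := by
        have : (0 : ℝ) < n := by linarith
        exact_mod_cast this
      rw [div_le_iff₀ hΔsq] at hn'
      choose A hA hmin using fun s : Fin n → (V × V × V) × Bool =>
        exists_empirical_minimizer hnt.nonempty s
      exact ⟨A, nastyPACLearns_of_empirical_minimizer hH hd hd1 hδ0 hδ1 hΔ0 hΔ1 hn0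
        (by linarith) hA hmin⟩
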